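/- Let $\Gamma$ be a locally finite graph (loops and parallel edges allowed), viewed as a one-dimensional CW complex. An end of $\Gamma$ is an equivalence class of proper rays $r:[0,\infty)\to\Gamma$, where $r$ and $s$ are equivalent if for every compact $K\subseteq\Gamma$ and all sufficiently large $t$ the points $r(t)$ and $s(t)$ are joined by a path in $\Gamma\setminus K$. Let $|\Gamma|$ be the union of $\Gamma$ and its set of ends, topologised so that $U\subseteq|\Gamma|$ is open if and only if $U\cap\Gamma$ is open in $\Gamma$ and, for every end in $U$ and every proper ray $r$ representing it, there is a compact $K\subseteq\Gamma$ such that $U$ contains all points $x\in\Gamma$ that are joined to $r(t)$ by a path in $\Gamma\setminus K$ for all sufficiently large $t$, and all ends of proper rays $s$ such that $s(t)$ is joined to $r(t)$ by a path in $\Gamma\setminus K$ for all sufficiently large $t$. (For connected $\Gamma$ this is the end compactification of $\Gamma$.) Then for every subgraph $\Gamma'$ of $\Gamma$ and every base point $x\in\Gamma'$, the inclusion $\Gamma'\to|\Gamma|$ induces an injective homomorphism $\pi_1(\Gamma',x)\to\pi_1(|\Gamma|,x)$; that is, every loop in $\Gamma'$ that is nontrivial in $\pi_1(\Gamma')$ stays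 nontrivial in $\pi_1(|\Gamma|)$. -/

import Mathlib

open Set Filter Topology
open scoped unitInterval NNReal

universe u v

/-! ### Graphs as one-dimensional CW complexes -/

namespace Graph

variable {α : Type u} {β : Type v}

/-- A graph (loops and parallel edges are allowed) is locally finite if every vertex is incident
with only finitely many edges. -/
def IsLocallyFinite (G : Graph α β) : Prop :=
  ∀ x ∈ V(G), {e | G.Inc e x}.Finite

/-- An ordered pair of ends satisfying a given incidence predicate: an arbitrary choice that
depends only on the predicate, so that an edge gets the same orientation in a graph and in its
subgraphs. -/
noncomputable def orientation (L : α → α → Prop) (h : ∃ p : α × α, L p.1 p.2) : α × α :=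
  Classical.choose h

theorem orientation_spec (L : α → α → Prop) (h : ∃ p : α × α, L p.1 p.2) :
    L (orientation L h).1 (orientation L h).2 :=
  Classical.choose_spec h

theorem orientation_congr {L L' : α → α → Prop} (hL : L = L') (h : ∃ p : α × α, L p.1 p.2)
    (h' : ∃ p : α × α, L' p.1 p.2) : orientation L h = orientation L' h' := by
  subst hL
  rfl

theorem exists_link (G : Graph α β) (e : E(G)) : ∃ p : α × α, G.IsLink e p.1 p.2 := by
  obtain ⟨x, y, h⟩ := (G.edge_mem_iff_exists_isLink e).1 e.2
  exact ⟨(x, y), h⟩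

/-- The initial vertex of an edge, for the chosen orientation. -/
noncomputable def tail (G : Graph α β) (e : E(G)) : V(G) :=
  ⟨(orientation (G.IsLink e) (G.exists_link e)).1, (orientation_spec _ (G.exists_link e)).left_mem⟩

/-- The terminal vertex of an edge, for the chosen orientation. -/
noncomputable def head (G : Graph α β) (e : E(G)) : V(G) :=
  ⟨(orientation (G.IsLink e) (G.exists_link e)).2, (orientation_spec _ (G.exists_link e)).right_mem⟩

/-- The gluing relation: the ends `(e, 0)` and `(e, 1)` of the interval belonging to the edge `e`
are glued to the initial and to the terminal vertex of `e`. -/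
inductive Glue (G : Graph α β) : V(G) ⊕ E(G) × I → V(G) ⊕ E(G) × I → Prop
  | tail (e : E(G)) : Glue G (Sum.inr (e, 0)) (Sum.inl (G.tail e))
  | head (e : E(G)) : Glue G (Sum.inr (e, 1)) (Sum.inl (G.head e))

/-- The graph as a one-dimensional CW complex: the disjoint union of the vertices and of one
unit interval for every edge, with the ends of the intervals glued to the vertices. -/
def Realization (G : Graph α β) : Type (max u v) := Quot G.Glue

/-- The point of the realization given by a vertex. -/
def vertexPt (G : Graph α β) (x : V(G)) : G.Realization := Quot.mk _ (Sum.inl x)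

/-- The characteristic map of an edge. -/
def edgePt (G : Graph α β) (e : E(G)) (t : I) : G.Realization := Quot.mk _ (Sum.inr (e, t))

/-- The CW (weak) topology: a set is open if and only if its preimage under the characteristic
map of every edge is open in the unit interval. -/
instance (G : Graph α β) : TopologicalSpace G.Realization :=
  ⨆ e : E(G), TopologicalSpace.coinduced (G.edgePt e) inferInstance

theorem tail_of_le {H G : Graph α β} (h : H ≤ G) (e : E(H)) :
    G.tail ⟨e, IsSubgraph.edgeSet_mono h e.2⟩ = ⟨H.tail e, IsSubgraph.vertexSet_mono h (H.tail e).2⟩ := by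
  have hL : G.IsLink e = H.IsLink e := (IsSubgraph.isLink_eqOn h e.2).symm
  exact Subtype.ext (congrArg Prod.fst (orientation_congr hL _ _))

theorem head_of_le {H G : Graph α β} (h : H ≤ G) (e : E(H)) :
    G.head ⟨e, IsSubgraph.edgeSet_mono h e.2⟩ = ⟨H.head e, IsSubgraph.vertexSet_mono h (H.head e).2⟩ := by
  have hL : G.IsLink e = H.IsLink e := (IsSubgraph.isLink_eqOn h e.2).symm
  exact Subtype.ext (congrArg Prod.snd (orientation_congr hL _ _))

/-- The inclusion of a subgraph, as a continuous map of realizations. -/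
def inclusion {H G : Graph α β} (h : H ≤ G) : C(H.Realization, G.Realization) where
  toFun := Quot.lift
    (Sum.elim (fun x => G.vertexPt ⟨x, IsSubgraph.vertexSet_mono h x.2⟩)
      (fun p => G.edgePt ⟨p.1, IsSubgraph.edgeSet_mono h p.1.2⟩ p.2))
    (by
      rintro _ _ (e | e)
      · exact (Quot.sound (Glue.tail _)).trans (congrArg G.vertexPt (tail_of_le h e))
      · exact (Quot.sound (Glue.head _)).trans (congrArg G.vertexPt (head_of_le h e)))
  continuous_toFun := by
    refine continuous_iSup_dom.2 fun e => continuous_coinduced_dom.2 ?_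
    exact continuous_iSup_rng (i := (⟨e, IsSubgraph.edgeSet_mono h e.2⟩ : E(G))) continuous_coinduced_rng

end Graph

/-! ### Ends and the end compactification

Compact sets play the role of closed balls around a base point: in a proper metric space every
compact set lies in a closed ball and closed balls are compact, so both give the same ends and
the same topology. No base point is needed, so `X` may be disconnected. -/

section Ends

variable (X : Type u) [TopologicalSpace X]

/-- A proper ray in `X`. -/
def ProperRay : Type u := {r : C(ℝ≥0, X) // IsProperMap r}

variable {X}

/-- The value of a proper ray at time `t`. -/
def ProperRay.at (r : ProperRay X) (t : ℝ≥0) : X := r.1 t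

/-- Two proper rays determine the same end if, for every compact set `K`, their points at all
sufficiently late times are joined by a path outside `K`. -/
def ProperRay.SameEnd (r s : ProperRay X) : Prop :=
  ∀ K : Set X, IsCompact K → ∀ᶠ t in atTop, JoinedIn Kᶜ (r.at t) (s.at t)

theorem ProperRay.eventually_notMem (r : ProperRay X) {K : Set X} (hK : IsCompact K) :
    ∀ᶠ t in atTop, r.at t ∉ K := by
  have h := (r.2.isCompact_preimage hK).compl_mem_cocompact
  have hle : (atTop : Filter ℝ≥0) ≤ cocompact ℝ≥0 := atTop_le_cocompact
  exact hle h

variable (X)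

/-- Determining the same end is an equivalence relation. -/
instance ProperRay.setoid : Setoid (ProperRay X) where
  r := ProperRay.SameEnd
  iseqv :=
    { refl := fun r _ hK => (r.eventually_notMem hK).mono fun _ ht => JoinedIn.refl ht
      symm := fun h K hK => (h K hK).mono fun _ ht => ht.symm
      trans := fun h h' K hK => ((h K hK).and (h' K hK)).mono fun _ ht => ht.1.trans ht.2 }

/-- The ends of `X`. -/
def Ends : Type u := Quotient (ProperRay.setoid X)

/-- The set `|X|` of the points and the ends of `X`. -/
inductive EndCompactification : Type u
  | point (x : X) : EndCompactification
  | ofEnd (ω : Ends X) : EndCompactification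

variable {X}

/-- The end determined by a proper ray, as a point of `|X|`. -/
def ProperRay.toEnd (r : ProperRay X) : EndCompactification X :=
  .ofEnd (Quotient.mk (ProperRay.setoid X) r)

/-- The basic neighbourhood of the end of `r` given by `K`: the points and the ends
that can be joined to the late points of `r` by paths outside `K`. -/
def ProperRay.basicNhd (r : ProperRay X) (K : Set X) : Set (EndCompactification X) :=
  {ω | ∃ s : ProperRay X, ω = s.toEnd ∧ ∀ᶠ t in atTop, JoinedIn Kᶜ (r.at t) (s.at t)} ∪
    {ξ | ∃ x : X, ξ = .point x ∧ ∀ᶠ t in atTop, JoinedIn Kᶜ (r.at t) x}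

theorem ProperRay.basicNhd_anti (r : ProperRay X) {K L : Set X} (h : K ⊆ L) :
    r.basicNhd L ⊆ r.basicNhd K := by
  rintro ξ (⟨s, rfl, hs⟩ | ⟨x, rfl, hx⟩)
  · exact Or.inl ⟨s, rfl, hs.mono fun _ ht => ht.mono (compl_subset_compl.2 h)⟩
  · exact Or.inr ⟨x, rfl, hx.mono fun _ ht => ht.mono (compl_subset_compl.2 h)⟩

/-- The topology of `|X|`: a set is open if its trace on `X` is open and if together with every
end it contains a basic neighbourhood of that end. -/
instance : TopologicalSpace (EndCompactification X) where
  IsOpen U := IsOpen (EndCompactification.point ⁻¹' U) ∧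
    ∀ r : ProperRay X, r.toEnd ∈ U → ∃ K : Set X, IsCompact K ∧ r.basicNhd K ⊆ U
  isOpen_univ := ⟨isOpen_univ, fun _ _ => ⟨∅, isCompact_empty, subset_univ _⟩⟩
  isOpen_inter := by
    rintro U V ⟨hU, hU'⟩ ⟨hV, hV'⟩
    refine ⟨hU.inter hV, fun r hr => ?_⟩
    obtain ⟨K, hK, hKU⟩ := hU' r hr.1
    obtain ⟨L, hL, hLV⟩ := hV' r hr.2
    exact ⟨K ∪ L, hK.union hL, subset_inter
      ((r.basicNhd_anti subset_union_left).trans hKU)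
      ((r.basicNhd_anti subset_union_right).trans hLV)⟩
  isOpen_sUnion := by
    intro S hS
    refine ⟨?_, ?_⟩
    · rw [preimage_sUnion]
      exact isOpen_biUnion fun U hU => (hS U hU).1
    · rintro r ⟨U, hU, hr⟩
      obtain ⟨K, hK, hKU⟩ := (hS U hU).2 r hr
      exact ⟨K, hK, hKU.trans (subset_sUnion_of_mem hU)⟩

variable (X)

/-- The inclusion of `X` into `|X|`. -/
def EndCompactification.incl : C(X, EndCompactification X) where
  toFun := EndCompactification.point
  continuous_toFun := ⟨fun _ hU => hU.1⟩

end Ends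

/-!
Two loops in `Γ'` that become homotopic in `|Γ|` have to be homotopic in `Γ'` already. Let `T` be
the union of their images, a compact subset of `Γ'` all of whose points are joined to the base
point `x` in `Γ'`. It is enough to find a continuous map `ρ : |Γ| → Γ'` that fixes every point of
`T`, since `ρ` carries a homotopy in `|Γ|` between the two loops to one in `Γ'`. No knowledge of
the fundamental group of a graph is needed.

As `T` is compact, only finitely many vertices lie in `T` and only finitely many open edges meet
`T` (`Graph.finite_inter_of_isCompact`). Let `F` be the set of these edges, and `W` the finite set
of the vertices in `T` and the ends of the edges in `F`. The map `ρ` is the identity on `W` and on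
the edges in `F`, and sends all other vertices and all ends of `Γ` to `x`. An edge outside `F` goes
to any path in `Γ'` between the images of its ends, and to the constant path at `x` if neither end
lies in `W`. Continuity at the ends of `Γ` is where local finiteness enters
(`Graph.exists_continuousMap_endCompactification`): only finitely many edges have an end in `W`,
and outside the compact set formed by `W` and these edges `ρ` is constant with value `x`.
-/

namespace Graph

variable {α : Type u} {β : Type v} {G H : Graph α β}

/-! ### Points of the realization -/

theorem edgePt_zero (e : E(G)) : G.edgePt e 0 = G.vertexPt (G.tail e) :=
  Quot.sound (Glue.tail e)

theorem edgePt_one (e : E(G)) : G.edgePt e 1 = G.vertexPt (G.head e) :=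
  Quot.sound (Glue.head e)

theorem Realization.ind {P : G.Realization → Prop} (hV : ∀ v, P (G.vertexPt v))
    (hE : ∀ e t, P (G.edgePt e t)) (y : G.Realization) : P y := by
  obtain ⟨v | ⟨e, t⟩⟩ := y
  exacts [hV v, hE e t]

open Classical in
/-- The unique representative of a point of the realization that is a vertex or an interior point
of an edge. -/
noncomputable def Realization.normalForm : G.Realization → V(G) ⊕ E(G) × I :=
  Quot.lift
    (Sum.elim Sum.inl fun p =>
      if p.2 = 0 then Sum.inl (G.tail p.1) else if p.2 = 1 then Sum.inl (G.head p.1) else Sum.inr p)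
    (by rintro _ _ (e | e) <;> simp)

theorem normalForm_vertexPt (v : V(G)) : (G.vertexPt v).normalForm = Sum.inl v := rfl

theorem normalForm_edgePt (e : E(G)) {t : I} (h0 : t ≠ 0) (h1 : t ≠ 1) :
    (G.edgePt e t).normalForm = Sum.inr (e, t) :=
  (if_neg h0).trans (if_neg h1)

theorem vertexPt_injective : Function.Injective G.vertexPt := fun _ _ h =>
  Sum.inl_injective (congrArg Realization.normalForm h)

theorem edgePt_eq_vertexPt {e : E(G)} {t : I} {v : V(G)} (h : G.edgePt e t = G.vertexPt v) :
    t = 0 ∨ t = 1 := by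
  by_contra! ht
  have := congrArg Realization.normalForm h
  rw [normalForm_edgePt e ht.1 ht.2, normalForm_vertexPt] at this
  cases this

theorem edgePt_eq_edgePt {e f : E(G)} {t s : I} (h0 : s ≠ 0) (h1 : s ≠ 1)
    (h : G.edgePt e t = G.edgePt f s) : e = f ∧ t = s := by
  have h' : (G.edgePt e t).normalForm = Sum.inr (f, s) := h ▸ normalForm_edgePt f h0 h1
  rcases eq_or_ne t 0 with rfl | ht0
  · rw [edgePt_zero, normalForm_vertexPt] at h'
    cases h'
  rcases eq_or_ne t 1 with rfl | ht1
  · rw [edgePt_one, normalForm_vertexPt] at h'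
    cases h'
  rw [normalForm_edgePt e ht0 ht1] at h'
  cases h'
  exact ⟨rfl, rfl⟩

/-! ### The weak topology -/

theorem continuous_edgePt (e : E(G)) : Continuous (G.edgePt e) :=
  continuous_iSup_rng continuous_coinduced_rng

theorem continuous_realization_dom {Y : Type*} [TopologicalSpace Y] {f : G.Realization → Y} :
    Continuous f ↔ ∀ e, Continuous (f ∘ G.edgePt e) := by
  simp_rw [continuous_iSup_dom, continuous_coinduced_dom]

theorem isClosed_realization_iff {A : Set G.Realization} :
    IsClosed A ↔ ∀ e, IsClosed (G.edgePt e ⁻¹' A) := by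
  simp_rw [← isOpen_compl_iff, isOpen_iSup_iff, isOpen_coinduced, preimage_compl]

/-- A set of points of the realization that meets every closed edge in a finite set is closed and
discrete, so a compact set contains only finitely many of its points. -/
theorem finite_inter_of_isCompact {A T : Set G.Realization}
    (hA : ∀ e, (G.edgePt e ⁻¹' A).Finite) (hT : IsCompact T) : (T ∩ A).Finite := by
  have hcl : ∀ B ⊆ A, IsClosed B := fun B hB =>
    isClosed_realization_iff.2 fun e => ((hA e).subset (preimage_mono hB)).isClosed
  have : DiscreteTopology ↥(T ∩ A) := discreteTopology_iff_forall_isClosed.2 fun B =>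
    ⟨⟨(Subtype.val '' B)ᶜ,
      (hcl _ ((Subtype.coe_image_subset _ B).trans inter_subset_right)).isOpen_compl,
      by rw [preimage_compl, preimage_image_eq B Subtype.val_injective]⟩⟩
  exact (hT.inter_right (hcl A Subset.rfl)).finite ⟨this⟩

theorem finite_setOf_vertexPt_mem {T : Set G.Realization} (hT : IsCompact T) :
    {v | G.vertexPt v ∈ T}.Finite := by
  have h := finite_inter_of_isCompact (A := range G.vertexPt)
    (fun e => (toFinite {0, 1}).subset
      (by rintro t ⟨v, hv⟩; exact edgePt_eq_vertexPt hv.symm)) hT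
  exact (h.preimage vertexPt_injective.injOn).subset fun v hv => ⟨hv, v, rfl⟩

theorem finite_setOf_edge_meets {T : Set G.Realization} (hT : IsCompact T) :
    {e | ∃ t, t ≠ 0 ∧ t ≠ 1 ∧ G.edgePt e t ∈ T}.Finite := by
  set F : Set E(G) := {e | ∃ t, t ≠ 0 ∧ t ≠ 1 ∧ G.edgePt e t ∈ T}
  -- Choosing one interior point of each such edge gives a set to which compactness applies.
  choose c hc0 hc1 hcT using fun e : F => e.2
  have h := finite_inter_of_isCompact (A := range fun e : F => G.edgePt e (c e))
    (fun e => Set.Subsingleton.finite (by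
      rintro t ⟨f, hf⟩ s ⟨g, hg⟩
      obtain ⟨rfl, rfl⟩ := edgePt_eq_edgePt (hc0 f) (hc1 f) hf.symm
      obtain ⟨hfg, rfl⟩ := edgePt_eq_edgePt (hc0 g) (hc1 g) hg.symm
      rw [Subtype.ext hfg])) hT
  have hinj : Function.Injective fun e : F => G.edgePt e (c e) := fun e f hef =>
    Subtype.ext (edgePt_eq_edgePt (hc0 f) (hc1 f) hef).1
  exact finite_coe_iff.1 (finite_univ_iff.1
    ((h.preimage hinj.injOn).subset fun e _ => ⟨hcT e, e, rfl⟩))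

/-! ### Maps out of the end compactification -/

theorem inc_tail (e : E(G)) : G.Inc e (G.tail e) :=
  (orientation_spec _ (G.exists_link e)).inc_left

theorem inc_head (e : E(G)) : G.Inc e (G.head e) :=
  (orientation_spec _ (G.exists_link e)).inc_right

/-- The map from the realization given by the images of the vertices and of the edges. -/
noncomputable def realizationLift {Y : Type*} [TopologicalSpace Y] (q : V(G) → Y)
    (p : ∀ e : E(G), Path (q (G.tail e)) (q (G.head e))) : C(G.Realization, Y) where
  toFun := Quot.lift (Sum.elim q fun z => p z.1 z.2) (by
    rintro _ _ (e | e)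
    exacts [(p e).source, (p e).target])
  continuous_toFun := continuous_realization_dom.2 fun e => (p e).continuous

/-- A map of a locally finite graph that sends all but finitely many vertices to one point, and all
edges between these to the same point, extends to the end compactification by sending all ends to
that point. -/
theorem exists_continuousMap_endCompactification (hG : G.IsLocallyFinite) {Y : Type*}
    [TopologicalSpace Y] {y₀ : Y} {W : Set V(G)} (hW : W.Finite) {q : V(G) → Y}
    (hq : ∀ v ∉ W, q v = y₀) (p : ∀ e : E(G), Path (q (G.tail e)) (q (G.head e)))
    (hp : ∀ e, G.tail e ∉ W → G.head e ∉ W → ∀ t, p e t = y₀) :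
    ∃ ρ : C(EndCompactification G.Realization, Y),
      (∀ v, ρ (.point (G.vertexPt v)) = q v) ∧ ∀ e t, ρ (.point (G.edgePt e t)) = p e t := by
  let S : Set E(G) := {e | G.tail e ∈ W ∨ G.head e ∈ W}
  have hS : S.Finite := by
    refine ((hW.biUnion fun v _ => hG v v.2).preimage Subtype.val_injective.injOn).subset ?_
    rintro e (he | he)
    exacts [mem_biUnion he (inc_tail e), mem_biUnion he (inc_head e)]
  -- `W` is needed besides the edges, since it may contain isolated vertices.
  let K : Set G.Realization := G.vertexPt '' W ∪ ⋃ e ∈ S, range (G.edgePt e)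
  have hK : IsCompact K := (hW.image _).isCompact.union
    (hS.isCompact_biUnion fun e _ => isCompact_range (continuous_edgePt e))
  have hρK : ∀ y ∉ K, realizationLift q p y = y₀ := by
    refine Realization.ind (fun v hv => hq v fun hvW => hv (Or.inl (mem_image_of_mem _ hvW)))
      fun e t he => ?_
    have heS : e ∉ S := fun h => he (Or.inr (mem_biUnion h (mem_range_self t)))
    exact hp e (fun h => heS (Or.inl h)) (fun h => heS (Or.inr h)) t
  let ρ : EndCompactification G.Realization → Y :=
    EndCompactification.rec (motive := fun _ => Y) (realizationLift q p) fun _ => y₀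
  refine ⟨⟨ρ, ⟨fun U hU =>
    ⟨hU.preimage (realizationLift q p).continuous, fun r hr => ⟨K, hK, ?_⟩⟩⟩⟩,
    fun _ => rfl, fun _ _ => rfl⟩
  rintro _ (⟨s, rfl, -⟩ | ⟨y, rfl, hy⟩)
  · exact hr
  -- A point of the neighbourhood `r.basicNhd K` is the end of a path outside `K`, so not in `K`.
  · obtain ⟨t, ht⟩ := hy.exists
    exact ((hρK y ht.target_mem).symm ▸ hr : realizationLift q p y ∈ U)

/-! ### Retracting onto a compact part of a subgraph -/

open Classical in
/-- A compact set of points of a subgraph, all joined to `x` in the subgraph, is fixed by some map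
from the end compactification of the whole graph to the subgraph. -/
theorem exists_continuousMap_fixing (hG : G.IsLocallyFinite) (hHG : H ≤ G) {x : H.Realization}
    {T : Set H.Realization} (hT : IsCompact T) (hTx : ∀ y ∈ T, Joined x y) :
    ∃ ρ : C(EndCompactification G.Realization, H.Realization),
      ∀ y ∈ T, ρ (.point (inclusion hHG y)) = y := by
  let ιV : V(H) → V(G) := fun v => ⟨v, IsSubgraph.vertexSet_mono hHG v.2⟩
  let ιE : E(H) → E(G) := fun e => ⟨e, IsSubgraph.edgeSet_mono hHG e.2⟩
  have hιV : Function.Injective ιV := fun v w h => Subtype.ext (congrArg Subtype.val h :)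
  have hιE : Function.Injective ιE := fun e f h => Subtype.ext (congrArg Subtype.val h :)
  let F : Set E(H) := {e | ∃ t, t ≠ 0 ∧ t ≠ 1 ∧ H.edgePt e t ∈ T}
  have hF : F.Finite := finite_setOf_edge_meets hT
  let W : Set V(H) := {v | H.vertexPt v ∈ T} ∪ (H.tail '' F ∪ H.head '' F)
  have hW : W.Finite :=
    (finite_setOf_vertexPt_mem hT).union ((hF.image _).union (hF.image _))
  have hWx : ∀ v ∈ W, Joined x (H.vertexPt v) := by
    have key : ∀ (e : E(H)) (s t : I), Joined (H.edgePt e s) (H.edgePt e t) := fun e s t =>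
      ⟨Path.subpath ⟨⟨H.edgePt e, continuous_edgePt e⟩, rfl, rfl⟩ s t⟩
    rintro v (hv | ⟨e, ⟨t, -, -, ht⟩, rfl⟩ | ⟨e, ⟨t, -, -, ht⟩, rfl⟩)
    · exact hTx _ hv
    · exact (hTx _ ht).trans (edgePt_zero e ▸ key e t 0)
    · exact (hTx _ ht).trans (edgePt_one e ▸ key e t 1)
  let q : V(G) → H.Realization := fun v => if h : ∃ w ∈ W, ιV w = v then H.vertexPt h.choose else x
  have hqW : ∀ w ∈ W, q (ιV w) = H.vertexPt w := fun w hw => by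
    have h : ∃ w' ∈ W, ιV w' = ιV w := ⟨w, hw, rfl⟩
    simp only [q, dif_pos h]
    exact congrArg _ (hιV h.choose_spec.2)
  have hqx : ∀ v ∉ ιV '' W, q v = x := fun v hv => dif_neg hv
  have hqJ : ∀ v, Joined x (q v) := fun v => by
    by_cases h : v ∈ ιV '' W
    · obtain ⟨w, hw, rfl⟩ := h
      rw [hqW w hw]
      exact hWx w hw
    · rw [hqx v h]
  have hp : ∀ e : E(G), ∃ p : Path (q (G.tail e)) (q (G.head e)),
      (G.tail e ∉ ιV '' W → G.head e ∉ ιV '' W → ∀ t, p t = x) ∧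
      ∀ f ∈ F, ιE f = e → ∀ t, p t = H.edgePt f t := by
    intro e
    by_cases he : ∃ f ∈ F, ιE f = e
    · obtain ⟨f, hf, rfl⟩ := he
      have htW : H.tail f ∈ W := Or.inr (Or.inl (mem_image_of_mem _ hf))
      have hhW : H.head f ∈ W := Or.inr (Or.inr (mem_image_of_mem _ hf))
      have ht : G.tail (ιE f) = ιV (H.tail f) := tail_of_le hHG f
      have hh : G.head (ιE f) = ιV (H.head f) := head_of_le hHG f
      refine ⟨⟨⟨H.edgePt f, continuous_edgePt f⟩, ?_, ?_⟩,
        fun h => (h (ht ▸ mem_image_of_mem _ htW)).elim, fun g _ hgf t => ?_⟩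
      · exact (edgePt_zero f).trans (by rw [ht, hqW _ htW])
      · exact (edgePt_one f).trans (by rw [hh, hqW _ hhW])
      · rw [hιE hgf]
        rfl
    · by_cases hc : G.tail e ∉ ιV '' W ∧ G.head e ∉ ιV '' W
      · exact ⟨(Path.refl x).cast (hqx _ hc.1) (hqx _ hc.2), fun _ _ _ => rfl,
          fun f hf hfe => (he ⟨f, hf, hfe⟩).elim⟩
      · exact ⟨((hqJ _).symm.trans (hqJ _)).somePath, fun h h' => (hc ⟨h, h'⟩).elim,
          fun f hf hfe => (he ⟨f, hf, hfe⟩).elim⟩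
  choose p hpx hpF using hp
  obtain ⟨ρ, hρV, hρE⟩ := exists_continuousMap_endCompactification hG (hW.image ιV) hqx p hpx
  have hV : ∀ v, H.vertexPt v ∈ T →
      ρ (.point (inclusion hHG (H.vertexPt v))) = H.vertexPt v := fun v hv =>
    (hρV (ιV v)).trans (hqW v (Or.inl hv))
  refine ⟨ρ, Realization.ind hV fun e t he => ?_⟩
  rcases eq_or_ne t 0 with rfl | h0
  · rw [edgePt_zero] at he ⊢
    exact hV _ he
  rcases eq_or_ne t 1 with rfl | h1
  · rw [edgePt_one] at he ⊢
    exact hV _ he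
  exact (hρE (ιE e) t).trans (hpF _ e ⟨t, h0, h1, he⟩ rfl t)

end Graph

theorem mainTheorem8 {α : Type u} {β : Type v} (Γ : Graph α β) (hΓ : Γ.IsLocallyFinite)
    (Γ' : Graph α β) (hΓ' : Γ' ≤ Γ) (x : Γ'.Realization) :
    Function.Injective
      (FundamentalGroup.map
        ((EndCompactification.incl Γ.Realization).comp (Graph.inclusion hΓ')) x) := by
  intro a b
  refine Path.Homotopic.Quotient.ind₂ (fun γ δ hγδ => ?_) a b
  set f := (EndCompactification.incl Γ.Realization).comp (Graph.inclusion hΓ')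
  have hhom : (γ.map f.continuous).Homotopic (δ.map f.continuous) :=
    Path.Homotopic.Quotient.exact hγδ
  have hjoin : ∀ (η : Path x x) (t : I), Joined x (η t) := fun η t =>
    ⟨(η.subpath 0 t).cast η.source.symm rfl⟩
  obtain ⟨ρ, hρ⟩ := Graph.exists_continuousMap_fixing hΓ hΓ' (x := x) (T := range γ ∪ range δ)
    ((isCompact_range γ.continuous).union (isCompact_range δ.continuous)) (by
      rintro _ (⟨t, rfl⟩ | ⟨t, rfl⟩)
      exacts [hjoin γ t, hjoin δ t])
  have hx : x = ρ (f x) := (hρ x (Or.inl ⟨0, γ.source⟩)).symm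
  have h := (hhom.map ρ).pathCast hx hx
  have hγ : ((γ.map f.continuous).map ρ.continuous).cast hx hx = γ :=
    Path.ext (funext fun t => hρ _ (Or.inl (mem_range_self t)))
  have hδ : ((δ.map f.continuous).map ρ.continuous).cast hx hx = δ :=
    Path.ext (funext fun t => hρ _ (Or.inr (mem_range_self t)))
  rw [hγ, hδ] at h
  exact Path.Homotopic.Quotient.eq.2 h
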